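/- For $c\in\mathbb C$ and a positive integer $n$ let $\sigma_c(n)=\sum_{d\mid n}d^c$, where the sum runs over the positive divisors $d$ of $n$ and $d^c=e^{c\log d}$ with the real logarithm. Let $R(c)=\{\sigma_c(n): n\in\mathbb N,\ n\geq 1\}$ be the range of $\sigma_c$. Write $c=a+bi$ with $a,b\in\mathbb R$. Then $R(c)$ is dense in $\mathbb C$ if and only if $-1\leq a\leq 0$ and $b\neq 0$. -/

import Mathlib

/-- The divisor function `σ_c(n) = ∑_{d ∣ n} d ^ c` with a complex exponent `c`. The divisors `d`
of `n` are positive, so `(d : ℂ) ^ c = exp (c * log d)` with the real logarithm of `d`. -/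
noncomputable def divisorSigma (c : ℂ) (n : ℕ) : ℂ :=
  ∑ d ∈ n.divisors, (d : ℂ) ^ c

/-- The range `R(c)` of `σ_c` on the positive integers. -/
def divisorSigmaRange (c : ℂ) : Set ℂ :=
  {z : ℂ | ∃ n : ℕ, 0 < n ∧ divisorSigma c n = z}

section

open Complex LSeries Filter Topology ComplexConjugate

/-! Density fails for elementary reasons: the range is real if b = 0, bounded if a < -1, and bounded
away from 0 if a > 0 (`not_dense_divisorSigmaRange_of_pos`).

Density rests on `not_summable_primes_arc`: the primes with p^(ib) near a given unit u have
divergent reciprocal sum. If -1 ≤ a < 0, write a target as exp(tu) with t ≥ 0. Large primes in that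
arc have log(1 + p^c) ≈ p^a u, and since p^a is small with divergent sum, some finite sum of the p^a
is close to t. If a = 0 the factors do not tend to 1, but they approximate every 1 + u; products of
two such numbers fill a neighbourhood of 1, whose powers give every nonzero number. -/

/-! ### The Dirichlet series of log ζ near the line Re s = 1. -/

/-- The coefficients `Λ(n) / log n` of the Dirichlet series of `log ζ`. -/
noncomputable def logZetaCoeff (n : ℕ) : ℝ := ArithmeticFunction.vonMangoldt n / Real.log n

lemma logZetaCoeff_nonneg (n : ℕ) : 0 ≤ logZetaCoeff n :=
  div_nonneg ArithmeticFunction.vonMangoldt_nonneg (Real.log_natCast_nonneg n)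

lemma logZetaCoeff_le_one (n : ℕ) : logZetaCoeff n ≤ 1 :=
  div_le_one_of_le₀ ArithmeticFunction.vonMangoldt_le_log (Real.log_natCast_nonneg n)

lemma logZetaCoeff_prime {p : ℕ} (hp : p.Prime) : logZetaCoeff p = 1 := by
  rw [logZetaCoeff, ArithmeticFunction.vonMangoldt_apply_prime hp]
  exact div_self (Real.log_pos (by exact_mod_cast hp.one_lt)).ne'

lemma logZetaCoeff_le (n : ℕ) :
    logZetaCoeff n ≤ (Real.log 2)⁻¹ * ArithmeticFunction.vonMangoldt n := by
  have h2 : 0 < Real.log 2 := Real.log_pos one_lt_two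
  rcases lt_or_ge n 2 with hn | hn
  · have : logZetaCoeff n = 0 := by interval_cases n <;> simp [logZetaCoeff]
    rw [this]
    exact mul_nonneg (inv_nonneg.2 h2.le) ArithmeticFunction.vonMangoldt_nonneg
  · rw [logZetaCoeff, div_eq_inv_mul]
    have : Real.log 2 ≤ Real.log n := Real.log_le_log two_pos (by exact_mod_cast hn)
    gcongr

lemma summable_logZetaCoeff_nonprime_div :
    Summable fun n : ℕ ↦ (if n.Prime then 0 else logZetaCoeff n) / n := by
  -- Modulo 1 there is a single residue class, containing every n.
  have h := ArithmeticFunction.vonMangoldt.summable_residueClass_non_primes_div (q := 1) 0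
  refine (h.mul_left (Real.log 2)⁻¹).of_nonneg_of_le (fun n ↦ ?_) fun n ↦ ?_
  · split_ifs
    · simp
    · exact div_nonneg (logZetaCoeff_nonneg n) n.cast_nonneg
  · split_ifs
    · simp
    · rw [← mul_div_assoc]
      refine div_le_div_of_nonneg_right ((logZetaCoeff_le n).trans_eq ?_) n.cast_nonneg
      congr 1
      rw [ArithmeticFunction.vonMangoldt.residueClass, Set.indicator_of_mem]
      exact Subsingleton.elim _ _

lemma LSeriesSummable_logZetaCoeff {s : ℂ} (hs : 1 < s.re) :
    LSeriesSummable (fun n ↦ (logZetaCoeff n : ℂ)) s :=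
  LSeriesSummable_of_bounded_of_one_lt_re (m := 1)
    (fun n _ ↦ by
      rw [norm_real, Real.norm_of_nonneg (logZetaCoeff_nonneg n)]
      exact logZetaCoeff_le_one n) hs

lemma hasDerivAt_LSeries_logZetaCoeff {s : ℂ} (hs : 1 < s.re) :
    HasDerivAt (LSeries fun n ↦ (logZetaCoeff n : ℂ))
      (deriv riemannZeta s / riemannZeta s) s := by
  have habs : abscissaOfAbsConv (fun n ↦ (logZetaCoeff n : ℂ)) < s.re := by
    refine lt_of_le_of_lt (b := ((1 : ℝ) : EReal)) ?_ (by exact_mod_cast hs)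
    refine abscissaOfAbsConv_le_of_forall_lt_LSeriesSummable fun y hy ↦ ?_
    exact LSeriesSummable_logZetaCoeff (by simpa using hy)
  have h := LSeries_hasDerivAt habs
  have h2 : logMul (fun n ↦ (logZetaCoeff n : ℂ)) =
      fun n ↦ ((ArithmeticFunction.vonMangoldt n : ℝ) : ℂ) := by
    funext n
    rw [logMul, ← natCast_log, ← ofReal_mul, logZetaCoeff]
    congr 1
    rcases lt_or_ge n 2 with hn | hn
    · interval_cases n <;> simp
    · have : Real.log n ≠ 0 := (Real.log_pos (by exact_mod_cast hn)).ne'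
      field_simp
  rw [h2, ArithmeticFunction.LSeries_vonMangoldt_eq_deriv_riemannZeta_div hs] at h
  convert h using 1
  ring

/-- ζ has neither pole nor zero on the segment 1 ≤ Re s ≤ 2 at height t ≠ 0, so ζ'/ζ is bounded
there; the mean value inequality from s = 2 bounds log ζ. -/
lemma exists_norm_LSeries_logZetaCoeff_le {t : ℝ} (ht : t ≠ 0) :
    ∃ B : ℝ, ∀ s : ℝ, 1 < s → s ≤ 2 →
      ‖LSeries (fun n ↦ (logZetaCoeff n : ℂ)) (s + t * I)‖ ≤ B := by
  set F := LSeries fun n ↦ (logZetaCoeff n : ℂ) with hF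
  have hne (s : ℝ) : (s : ℂ) + t * I ≠ 1 := by
    intro h
    apply ht
    simpa using congrArg Complex.im h
  have hcont : ContinuousOn
      (fun s : ℝ ↦ deriv riemannZeta (s + t * I) / riemannZeta (s + t * I)) (Set.Icc 1 2) := by
    intro s hs
    have hdiff : DifferentiableOn ℂ riemannZeta {(1 : ℂ)}ᶜ := fun z hz ↦
      (differentiableAt_riemannZeta hz).differentiableWithinAt
    have h1 : ContinuousAt (deriv riemannZeta) ((s : ℂ) + t * I) :=
      ((hdiff.deriv isOpen_compl_singleton).differentiableAt
        (isOpen_compl_singleton.mem_nhds (hne s))).continuousAt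
    have h2 : ContinuousAt riemannZeta ((s : ℂ) + t * I) :=
      (differentiableAt_riemannZeta (hne s)).continuousAt
    have h3 : riemannZeta ((s : ℂ) + t * I) ≠ 0 :=
      riemannZeta_ne_zero_of_one_le_re (by simpa using hs.1)
    have hl : ContinuousAt (fun s : ℝ ↦ (s : ℂ) + t * I) s := by fun_prop
    exact ((ContinuousAt.comp (f := fun s : ℝ ↦ (s : ℂ) + t * I) h1 hl).div
      (ContinuousAt.comp (f := fun s : ℝ ↦ (s : ℂ) + t * I) h2 hl) h3).continuousWithinAt
  obtain ⟨C, hC⟩ := isCompact_Icc.exists_bound_of_continuousOn hcont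
  refine ⟨‖F ((2 : ℝ) + t * I)‖ + C, fun s hs1 hs2 ↦ ?_⟩
  have hder (x : ℝ) (hx : 1 < x) : HasDerivAt (fun s : ℝ ↦ F (s + t * I))
      (deriv riemannZeta (x + t * I) / riemannZeta (x + t * I)) x := by
    have h := hasDerivAt_LSeries_logZetaCoeff (s := (x : ℂ) + t * I) (by simpa using hx)
    exact (h.comp_add_const (x : ℂ) (t * I)).comp_ofReal
  have hmv := norm_image_sub_le_of_norm_deriv_le_segment' (a := s) (b := 2)
    (f := fun s : ℝ ↦ F (s + t * I)) (C := C)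
    (fun x hx ↦ (hder x (hs1.trans_le hx.1)).hasDerivWithinAt)
    (fun x hx ↦ hC x ⟨hs1.le.trans hx.1, hx.2.le⟩) 2 (Set.right_mem_Icc.2 hs2)
  have hC0 : 0 ≤ C := (norm_nonneg _).trans (hC 1 (by simp))
  have hle : C * (2 - s) ≤ C := mul_le_of_le_one_right hC0 (by linarith)
  calc ‖F (s + t * I)‖ = ‖F ((2 : ℝ) + t * I) - (F ((2 : ℝ) + t * I) - F (s + t * I))‖ := by
        rw [sub_sub_cancel]
    _ ≤ ‖F ((2 : ℝ) + t * I)‖ + ‖F ((2 : ℝ) + t * I) - F (s + t * I)‖ := norm_sub_le _ _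
    _ ≤ _ := by gcongr; exact hmv.trans hle

lemma LSeries_term_eq (f : ℕ → ℂ) (hf : f 0 = 0) (s : ℂ) (n : ℕ) :
    term f s n = f n * (n : ℂ) ^ (-s) := by
  rcases eq_or_ne n 0 with rfl | hn
  · simp [hf]
  · rw [term_of_ne_zero hn, cpow_neg, div_eq_mul_inv]

lemma logZetaCoeff_zero : logZetaCoeff 0 = 0 := by simp [logZetaCoeff]

lemma summable_logZetaCoeff_mul_rpow {s : ℝ} (hs : 1 < s) :
    Summable fun n : ℕ ↦ logZetaCoeff n * (n : ℝ) ^ (-s) := by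
  refine (Real.summable_nat_rpow.2 (by linarith : -s < -1)).of_nonneg_of_le (fun n ↦ ?_) fun n ↦ ?_
  · exact mul_nonneg (logZetaCoeff_nonneg n) (by positivity)
  · exact mul_le_of_le_one_left (by positivity) (logZetaCoeff_le_one n)

/-- A uniform bound would survive s → 1 in each finite sum over primes, making Σ 1/p converge. -/
lemma exists_tsum_logZetaCoeff_gt (C : ℝ) :
    ∃ s : ℝ, 1 < s ∧ s ≤ 2 ∧ C < ∑' n : ℕ, logZetaCoeff n * (n : ℝ) ^ (-s) := by
  by_contra! h
  refine not_summable_one_div_on_primes (summable_of_sum_le (c := C) (fun n ↦ ?_) fun S ↦ ?_)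
  · exact Set.indicator_nonneg (fun _ _ ↦ by positivity) _
  have hlim : Tendsto
      (fun s : ℝ ↦ ∑ n ∈ S, Set.indicator {p : ℕ | p.Prime} (fun n : ℕ ↦ (n : ℝ) ^ (-s)) n)
      (𝓝[>] 1)
      (𝓝 (∑ n ∈ S, Set.indicator {p : ℕ | p.Prime} (fun n : ℕ ↦ (1 : ℝ) / n) n)) := by
    refine tendsto_finsetSum _ fun n _ ↦ ?_
    by_cases hn : n.Prime
    · simp only [Set.indicator, Set.mem_ofPred_eq, hn, if_true]
      have hc : ContinuousAt (fun s : ℝ ↦ (n : ℝ) ^ (-s)) 1 :=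
        ContinuousAt.rpow (by fun_prop) (by fun_prop) (Or.inl (by exact_mod_cast hn.ne_zero))
      have := hc.tendsto.mono_left (nhdsWithin_le_nhds (s := Set.Ioi 1))
      simpa [Real.rpow_neg_one] using this
    · simp only [Set.indicator, Set.mem_ofPred_eq, hn, if_false]
      exact tendsto_const_nhds
  refine le_of_tendsto hlim ?_
  filter_upwards [Ioc_mem_nhdsGT (one_lt_two (α := ℝ))] with s hs
  refine le_trans ?_ (h s hs.1 hs.2)
  refine le_trans (Finset.sum_le_sum fun n _ ↦ ?_)
    ((summable_logZetaCoeff_mul_rpow hs.1).sum_le_tsum S fun n _ ↦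
      mul_nonneg (logZetaCoeff_nonneg n) (by positivity))
  by_cases hn : n.Prime
  · simp [Set.indicator, hn, logZetaCoeff_prime hn]
  · simp only [Set.indicator, Set.mem_ofPred_eq, hn, if_false]
    exact mul_nonneg (logZetaCoeff_nonneg n) (by positivity)

/-! ### Primes with p^(ib) in a prescribed arc. -/

lemma exists_pow_lt_centralBinom_div {r : ℝ} (h0 : 0 ≤ r) (h1 : r < 1) :
    ∃ N : ℕ, r ^ N < (N.centralBinom : ℝ) / 4 ^ N := by
  have h := tendsto_self_mul_const_pow_of_lt_one h0 h1
  have h2 := h.eventually (gt_mem_nhds (by norm_num : (0 : ℝ) < 1 / 2))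
  obtain ⟨N, hN, hN1⟩ := (h2.and (eventually_ge_atTop 1)).exists
  refine ⟨N, ?_⟩
  have hb : (4 : ℝ) ^ N ≤ 2 * N * N.centralBinom := by
    exact_mod_cast Nat.four_pow_le_two_mul_self_mul_centralBinom N hN1
  have hN0 : (0 : ℝ) < N := by exact_mod_cast hN1
  have hc : (0 : ℝ) < N.centralBinom := by exact_mod_cast N.centralBinom_pos
  rw [lt_div_iff₀ (by positivity)]
  calc r ^ N * 4 ^ N ≤ r ^ N * (2 * N * N.centralBinom) := by gcongr
    _ = 2 * (N * r ^ N) * N.centralBinom := by ring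
    _ < 2 * (1 / 2) * N.centralBinom := by gcongr
    _ = _ := by ring

lemma norm_one_add_sq_add_norm_sub_one_sq {z : ℂ} (hz : ‖z‖ = 1) :
    ‖1 + z‖ ^ 2 + ‖z - 1‖ ^ 2 = 4 := by
  have h : z.re ^ 2 + z.im ^ 2 = 1 := by
    have := Complex.sq_norm z
    rw [hz, normSq_apply] at this
    linarith
  rw [Complex.sq_norm, Complex.sq_norm, normSq_apply, normSq_apply]
  simp
  linarith

/-- On the unit circle |1 + z|² = z̄(1 + z)², so the kernel is a trigonometric polynomial; its
constant term, at j = N, is the central binomial coefficient over 4^N. -/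
lemma norm_one_add_sq_div_four_pow {z : ℂ} (hz : ‖z‖ = 1) (N : ℕ) :
    (((‖1 + z‖ ^ 2 / 4) ^ N : ℝ) : ℂ) =
      ∑ j ∈ Finset.range (2 * N + 1), ((2 * N).choose j / 4 ^ N : ℂ) * (z ^ j * conj z ^ N) := by
  have h1 : conj z * z = 1 := by rw [conj_mul', hz]; simp
  have h2 : ((‖1 + z‖ ^ 2 : ℝ) : ℂ) = conj z * (1 + z) ^ 2 := by
    push_cast
    rw [← conj_mul', map_add, map_one]
    linear_combination (-(1 + z)) * h1
  rw [ofReal_pow, ofReal_div, h2, div_pow, mul_pow, ← pow_mul, add_comm 1 z, add_pow,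
    Finset.mul_sum, Finset.sum_div]
  refine Finset.sum_congr rfl fun j _ ↦ ?_
  push_cast
  ring

lemma norm_natCast_cpow_ofReal_mul_I {n : ℕ} (hn : n ≠ 0) (b : ℝ) :
    ‖(n : ℂ) ^ (b * I)‖ = 1 := by
  rw [norm_natCast_cpow_of_pos (Nat.pos_of_ne_zero hn)]
  simp

lemma conj_natCast_cpow_ofReal_mul_I {n : ℕ} (hn : n ≠ 0) (b : ℝ) :
    conj ((n : ℂ) ^ (b * I)) = (n : ℂ) ^ (-(b * I)) := by
  rw [cpow_neg, inv_def, normSq_eq_norm_sq, norm_natCast_cpow_ofReal_mul_I hn]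
  simp

lemma hasSum_logZetaCoeff_mul_pow {s : ℝ} (hs : 1 < s) (b : ℝ) {u : ℂ} (hu : ‖u‖ = 1) (N : ℕ) :
    HasSum (fun n : ℕ ↦ ((logZetaCoeff n * (n : ℝ) ^ (-s) *
        (‖1 + (n : ℂ) ^ (b * I) * conj u‖ ^ 2 / 4) ^ N : ℝ) : ℂ))
      (∑ j ∈ Finset.range (2 * N + 1), ((2 * N).choose j / 4 ^ N : ℂ) * (conj u ^ j * u ^ N) *
        LSeries (fun n ↦ (logZetaCoeff n : ℂ)) (s + (((N : ℝ) - j) * b : ℝ) * I)) := by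
  have key (j : ℕ) : HasSum (fun n : ℕ ↦ ((2 * N).choose j / 4 ^ N : ℂ) * (conj u ^ j * u ^ N) *
      term (fun n ↦ (logZetaCoeff n : ℂ)) (s + (((N : ℝ) - j) * b : ℝ) * I) n)
      (((2 * N).choose j / 4 ^ N : ℂ) * (conj u ^ j * u ^ N) *
        LSeries (fun n ↦ (logZetaCoeff n : ℂ)) (s + (((N : ℝ) - j) * b : ℝ) * I)) := by
    refine HasSum.mul_left _ (LSeriesSummable_logZetaCoeff ?_).hasSum
    simpa using hs
  convert hasSum_sum fun j (_ : j ∈ Finset.range (2 * N + 1)) ↦ key j using 1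
  funext n
  rcases eq_or_ne n 0 with rfl | hn
  · simp [logZetaCoeff_zero]
  have hn' : (n : ℂ) ≠ 0 := Nat.cast_ne_zero.2 hn
  have hz : ‖(n : ℂ) ^ (b * I) * conj u‖ = 1 := by
    rw [norm_mul, norm_natCast_cpow_ofReal_mul_I hn, RCLike.norm_conj, hu, one_mul]
  rw [ofReal_mul, norm_one_add_sq_div_four_pow hz, Finset.mul_sum]
  refine Finset.sum_congr rfl fun j _ ↦ ?_
  have hexp : (n : ℂ) ^ (-(s + (((N : ℝ) - j) * b : ℝ) * I) : ℂ) =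
      (n : ℂ) ^ (-s : ℂ) * ((n : ℂ) ^ (b * I)) ^ j * ((n : ℂ) ^ (-(b * I))) ^ N := by
    rw [← cpow_nat_mul, ← cpow_nat_mul, ← cpow_add _ _ hn', ← cpow_add _ _ hn']
    congr 1
    push_cast
    ring
  rw [LSeries_term_eq _ (by simp [logZetaCoeff_zero]), hexp, map_mul,
    conj_natCast_cpow_ofReal_mul_I hn, conj_conj, ofReal_mul, ofReal_cpow n.cast_nonneg]
  push_cast
  ring

/-- Weight log ζ(s) by the kernel peaked at u. As s → 1 only the constant frequency is unbounded, so
the weighted sum is at least P · C(2N,N)/4^N up to a constant. If the arc sum converged, it would be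
at most r^N P up to a constant, a contradiction for suitable N. -/
theorem not_summable_primes_arc {b : ℝ} (hb : b ≠ 0) {u : ℂ} (hu : ‖u‖ = 1) {δ : ℝ} (hδ : 0 < δ) :
    ¬ Summable (Set.indicator {p : ℕ | p.Prime ∧ ‖(p : ℂ) ^ (b * I) - u‖ < δ}
      fun n : ℕ ↦ (1 : ℝ) / n) := by
  wlog hδ1 : δ ≤ 1 generalizing δ
  · intro h
    refine this one_pos le_rfl (h.of_nonneg_of_le
      (fun n ↦ Set.indicator_nonneg (fun _ _ ↦ by positivity) _)
      (fun n ↦ Set.indicator_le_indicator_of_subset (fun p (hp : _ ∧ _) ↦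
        And.intro hp.1 (hp.2.trans (not_le.1 hδ1))) (fun _ ↦ by positivity) n))
  intro hsum
  -- An upper bound for the kernel's base off the arc, by |1 + z|² + |z - 1|² = 4.
  set r : ℝ := 1 - δ ^ 2 / 4 with hr
  have hr0 : 0 ≤ r := by nlinarith
  have hr1 : r < 1 := by nlinarith
  obtain ⟨N, hN⟩ := exists_pow_lt_centralBinom_div hr0 hr1
  have hB (j : ℕ) : ∃ B : ℝ, j ≠ N → ∀ s : ℝ, 1 < s → s ≤ 2 →
      ‖LSeries (fun n ↦ (logZetaCoeff n : ℂ)) (s + (((N : ℝ) - j) * b : ℝ) * I)‖ ≤ B := by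
    by_cases hj : j = N
    · exact ⟨0, fun h ↦ (h hj).elim⟩
    · obtain ⟨B, h⟩ := exists_norm_LSeries_logZetaCoeff_le
        (t := ((N : ℝ) - j) * b)
        (mul_ne_zero (sub_ne_zero.2 (by exact_mod_cast Ne.symm hj)) hb)
      exact ⟨B, fun _ ↦ h⟩
  choose B hB using hB
  set T : ℕ → ℝ := fun n ↦ ‖1 + (n : ℂ) ^ (b * I) * conj u‖ ^ 2 / 4 with hT
  set h : ℕ → ℝ := fun n ↦ Set.indicator {p : ℕ | p.Prime ∧ ‖(p : ℂ) ^ (b * I) - u‖ < δ}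
      (fun n : ℕ ↦ (1 : ℝ) / n) n + (if n.Prime then 0 else logZetaCoeff n) / n with hh
  have hhs : Summable h := hsum.add summable_logZetaCoeff_nonprime_div
  set E : ℝ := ∑ j ∈ (Finset.range (2 * N + 1)).erase N, (2 * N).choose j / 4 ^ N * B j with hE
  obtain ⟨s, hs1, hs2, hs⟩ := exists_tsum_logZetaCoeff_gt
    (((∑' n, h n) + E) / ((N.centralBinom : ℝ) / 4 ^ N - r ^ N))
  rw [div_lt_iff₀ (sub_pos.2 hN)] at hs
  set P : ℝ := ∑' n : ℕ, logZetaCoeff n * (n : ℝ) ^ (-s) with hP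
  have hPs := summable_logZetaCoeff_mul_rpow hs1
  have hsumT := hasSum_logZetaCoeff_mul_pow hs1 b hu N
  have hsT : Summable fun n : ℕ ↦ logZetaCoeff n * (n : ℝ) ^ (-s) * T n ^ N :=
    Complex.summable_ofReal.1 hsumT.summable
  have hPF : LSeries (fun n ↦ (logZetaCoeff n : ℂ)) s = P := by
    rw [LSeries, hP, ofReal_tsum]
    refine tsum_congr fun n ↦ ?_
    rw [LSeries_term_eq _ (by simp [logZetaCoeff_zero])]
    push_cast
    rw [ofReal_cpow n.cast_nonneg]
    simp
  have lower : (N.centralBinom : ℝ) / 4 ^ N * P - E ≤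
      ∑' n : ℕ, logZetaCoeff n * (n : ℝ) ^ (-s) * T n ^ N := by
    have heq := hsumT.tsum_eq
    rw [← ofReal_tsum, ← Finset.add_sum_erase _ _ (Finset.mem_range.2 (by omega : N < 2 * N + 1)),
      sub_self, zero_mul, ofReal_zero, zero_mul, add_zero, hPF] at heq
    have hu1 : conj u ^ N * u ^ N = 1 := by rw [← mul_pow, conj_mul', hu]; simp
    rw [hu1, mul_one] at heq
    have hle : ‖((∑' n : ℕ, logZetaCoeff n * (n : ℝ) ^ (-s) * T n ^ N : ℝ) : ℂ) -
        ((2 * N).choose N / 4 ^ N : ℂ) * P‖ ≤ E := by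
      rw [heq, add_sub_cancel_left]
      refine norm_sum_le_of_le _ fun j hj ↦ ?_
      rw [norm_mul, norm_mul, norm_mul, norm_pow, norm_pow, RCLike.norm_conj, hu, one_pow, one_pow,
        one_mul, mul_one, norm_div, norm_pow]
      simp only [Complex.norm_natCast, norm_ofNat]
      refine mul_le_mul_of_nonneg_left ?_ (by positivity)
      exact hB j (Finset.ne_of_mem_erase hj) s hs1 hs2
    have hle2 := (abs_le.1 ((Complex.abs_re_le_norm _).trans hle)).1
    have hre : (((2 * N).choose N / 4 ^ N : ℂ) * P).re = N.centralBinom / 4 ^ N * P := by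
      rw [Nat.centralBinom, ← ofReal_re (((2 * N).choose N : ℝ) / 4 ^ N * P)]
      push_cast
      rfl
    rw [sub_re, ofReal_re, hre] at hle2
    linarith
  have upper : ∑' n : ℕ, logZetaCoeff n * (n : ℝ) ^ (-s) * T n ^ N ≤
      r ^ N * P + ∑' n, h n := by
    rw [hP, ← tsum_mul_left, ← (hPs.mul_left _).tsum_add hhs]
    refine hsT.tsum_le_tsum (fun n ↦ ?_) ((hPs.mul_left _).add hhs)
    rcases eq_or_ne n 0 with rfl | hn
    · simp [hh, logZetaCoeff_zero, Set.indicator]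
    have hz : ‖(n : ℂ) ^ (b * I) * conj u‖ = 1 := by
      rw [norm_mul, norm_natCast_cpow_ofReal_mul_I hn, RCLike.norm_conj, hu, one_mul]
    have hTid := norm_one_add_sq_add_norm_sub_one_sq hz
    have hT0 : 0 ≤ T n := by positivity
    have hT1 : T n ≤ 1 := by
      simp only [hT]
      nlinarith [sq_nonneg ‖(n : ℂ) ^ (b * I) * conj u - 1‖]
    have hfn := logZetaCoeff_nonneg n
    have hn1 : (1 : ℝ) ≤ n := by exact_mod_cast Nat.one_le_iff_ne_zero.2 hn
    have hns : (n : ℝ) ^ (-s) ≤ 1 / n := by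
      rw [one_div, ← Real.rpow_neg_one]
      exact Real.rpow_le_rpow_of_exponent_le hn1 (by linarith)
    have hns0 : 0 ≤ (n : ℝ) ^ (-s) := by positivity
    have hTN : T n ^ N ≤ 1 := pow_le_one₀ hT0 hT1
    have hrN : 0 ≤ r ^ N := pow_nonneg hr0 N
    have hrest : 0 ≤ r ^ N * (logZetaCoeff n * (n : ℝ) ^ (-s)) := by positivity
    have hone : logZetaCoeff n * (n : ℝ) ^ (-s) * T n ^ N ≤ logZetaCoeff n / n := by
      rw [div_eq_mul_one_div, mul_assoc]
      gcongr
      exact (mul_le_of_le_one_right hns0 hTN).trans hns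
    by_cases hp : n.Prime
    · by_cases hc : ‖(n : ℂ) ^ (b * I) - u‖ < δ
      · simp only [hh, Set.indicator, Set.mem_ofPred_eq, hp, hc, and_self, if_true, zero_div]
        rw [logZetaCoeff_prime hp] at *
        linarith
      · simp only [hh, Set.indicator, Set.mem_ofPred_eq, hp, hc, and_false, if_true, zero_div,
          if_false, add_zero]
        have hdist : ‖(n : ℂ) ^ (b * I) * conj u - 1‖ = ‖(n : ℂ) ^ (b * I) - u‖ := by
          have : (n : ℂ) ^ (b * I) * conj u - 1 = ((n : ℂ) ^ (b * I) - u) * conj u := by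
            rw [sub_mul, mul_conj', hu]; simp
          rw [this, norm_mul, RCLike.norm_conj, hu, mul_one]
        have hTr : T n ≤ r := by
          rw [hdist] at hTid
          simp only [hT, hr]
          nlinarith [not_lt.1 hc]
        rw [mul_comm (r ^ N)]
        gcongr
    · simp only [hh, Set.indicator, Set.mem_ofPred_eq, hp, false_and, if_false, zero_add]
      linarith
  have := lower.trans upper
  nlinarith

/-! ### Multiplicativity of σ_c. -/

/-- The function `n ↦ n ^ c` as an arithmetic function. -/
noncomputable def cpowArith (c : ℂ) : ArithmeticFunction ℂ :=
  ⟨fun n ↦ if n = 0 then 0 else (n : ℂ) ^ c, if_pos rfl⟩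

lemma cpowArith_apply (c : ℂ) {n : ℕ} (hn : n ≠ 0) : cpowArith c n = (n : ℂ) ^ c := if_neg hn

lemma isMultiplicative_cpowArith (c : ℂ) : (cpowArith c).IsMultiplicative := by
  rw [ArithmeticFunction.IsMultiplicative.iff_ne_zero]
  refine ⟨by simp [cpowArith_apply], fun {m n} hm hn _ ↦ ?_⟩
  rw [cpowArith_apply c hm, cpowArith_apply c hn, cpowArith_apply c (mul_ne_zero hm hn)]
  rw [Nat.cast_mul, natCast_mul_natCast_cpow]

/-- The divisor function `σ_c` as an arithmetic function. -/
noncomputable def sigmaArith (c : ℂ) : ArithmeticFunction ℂ :=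
  cpowArith c * (ArithmeticFunction.zeta : ArithmeticFunction ℂ)

lemma isMultiplicative_sigmaArith (c : ℂ) : (sigmaArith c).IsMultiplicative :=
  (isMultiplicative_cpowArith c).mul ArithmeticFunction.isMultiplicative_zeta.natCast

lemma sigmaArith_apply (c : ℂ) (n : ℕ) : sigmaArith c n = divisorSigma c n := by
  rw [sigmaArith, ArithmeticFunction.coe_mul_zeta_apply, divisorSigma]
  exact Finset.sum_congr rfl fun d hd ↦ cpowArith_apply c (Nat.pos_of_mem_divisors hd).ne'

lemma divisorSigma_prime_pow (c : ℂ) {p : ℕ} (hp : p.Prime) (k : ℕ) :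
    divisorSigma c (p ^ k) = ∑ j ∈ Finset.range (k + 1), ((p : ℂ) ^ c) ^ j := by
  rw [divisorSigma, Nat.sum_divisors_prime_pow hp]
  refine Finset.sum_congr rfl fun j _ ↦ ?_
  rw [Nat.cast_pow, ← natCast_cpow_natCast_mul, cpow_nat_mul]

lemma divisorSigma_prime (c : ℂ) {p : ℕ} (hp : p.Prime) :
    divisorSigma c p = 1 + (p : ℂ) ^ c := by
  simpa [Finset.sum_range_succ] using divisorSigma_prime_pow c hp 1

lemma divisorSigma_prod_primes (c : ℂ) {S : Finset ℕ} (hS : ∀ p ∈ S, p.Prime) :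
    divisorSigma c (∏ p ∈ S, p) = ∏ p ∈ S, (1 + (p : ℂ) ^ c) := by
  rw [← sigmaArith_apply, (isMultiplicative_sigmaArith c).map_prod (fun p : ℕ ↦ p) S]
  · exact Finset.prod_congr rfl fun p hp ↦ by rw [sigmaArith_apply, divisorSigma_prime c (hS p hp)]
  · exact fun p hp q hq hpq ↦ (Nat.coprime_primes (hS p hp) (hS q hq)).2 hpq

lemma norm_natCast_cpow_add_mul_I {n : ℕ} (hn : 0 < n) (a b : ℝ) :
    ‖(n : ℂ) ^ ((a : ℂ) + b * I)‖ = (n : ℝ) ^ a := by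
  rw [norm_natCast_cpow_of_pos hn]
  simp

/-! ### The parameters without density. -/

lemma not_dense_divisorSigmaRange_real (a : ℝ) : ¬ Dense (divisorSigmaRange (a : ℂ)) := by
  intro h
  have hsub : divisorSigmaRange (a : ℂ) ⊆ {z : ℂ | z.im = 0} := by
    rintro z ⟨n, -, rfl⟩
    rw [Set.mem_ofPred_eq, divisorSigma, im_sum]
    refine Finset.sum_eq_zero fun d _ ↦ ?_
    rw [← ofReal_natCast, ← ofReal_cpow d.cast_nonneg, ofReal_im]
  have hcl : IsClosed {z : ℂ | z.im = 0} := isClosed_eq continuous_im continuous_const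
  have := closure_minimal hsub hcl (h I)
  simp at this

lemma not_dense_divisorSigmaRange_of_lt_neg_one {a : ℝ} (ha : a < -1) (b : ℝ) :
    ¬ Dense (divisorSigmaRange ((a : ℂ) + b * I)) := by
  intro h
  have hs : Summable fun n : ℕ ↦ (n : ℝ) ^ a := Real.summable_nat_rpow.2 ha
  set C := ∑' n : ℕ, (n : ℝ) ^ a with hC
  have hsub : divisorSigmaRange ((a : ℂ) + b * I) ⊆ Metric.closedBall 0 C := by
    rintro z ⟨n, -, rfl⟩
    rw [mem_closedBall_zero_iff, divisorSigma]
    refine (norm_sum_le _ _).trans ?_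
    rw [Finset.sum_congr rfl fun d hd ↦
      norm_natCast_cpow_add_mul_I (Nat.pos_of_mem_divisors hd) a b]
    exact hs.sum_le_tsum _ fun _ _ ↦ by positivity
  have hmem := closure_minimal hsub Metric.isClosed_closedBall (h ((C + 1 : ℝ) : ℂ))
  rw [mem_closedBall_zero_iff, norm_real, Real.norm_eq_abs] at hmem
  linarith [le_abs_self (C + 1)]

/-- The sum is (z^(k+1) - 1)/(z - 1), of norm at least (|z|² - 1)/(|z| + 1). -/
lemma norm_sub_one_le_norm_geom_sum {z : ℂ} (hz : 1 < ‖z‖) {k : ℕ} (hk : 1 ≤ k) :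
    ‖z‖ - 1 ≤ ‖∑ j ∈ Finset.range (k + 1), z ^ j‖ := by
  have hz1 : z ≠ 1 := by rintro rfl; simp at hz
  have hpos : 0 < ‖z - 1‖ := norm_pos_iff.2 (sub_ne_zero.2 hz1)
  refine le_of_mul_le_mul_right ?_ hpos
  rw [← norm_mul, geom_sum_mul]
  have h1 : ‖z - 1‖ ≤ ‖z‖ + 1 := by simpa using norm_sub_le z 1
  have h2 : ‖z‖ ^ (k + 1) - 1 ≤ ‖z ^ (k + 1) - 1‖ := by
    simpa using norm_sub_norm_le (z ^ (k + 1)) 1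
  have h3 : ‖z‖ ^ 2 ≤ ‖z‖ ^ (k + 1) := pow_le_pow_right₀ hz.le (by omega)
  nlinarith

/-- Each local factor has norm at least min(1, p^a - 1) > 0, which is 1 for all large p; the finite
product of the others keeps the range away from 0. -/
lemma not_dense_divisorSigmaRange_of_pos {a : ℝ} (ha : 0 < a) (b : ℝ) :
    ¬ Dense (divisorSigmaRange ((a : ℂ) + b * I)) := by
  intro h
  set c : ℂ := (a : ℂ) + b * I with hc
  set m : ℕ → ℝ := fun p ↦ min 1 ((p : ℝ) ^ a - 1) with hm
  have hmpos {p : ℕ} (hp : p.Prime) : 0 < m p :=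
    lt_min one_pos (sub_pos.2 (Real.one_lt_rpow (by exact_mod_cast hp.one_lt) ha))
  obtain ⟨M, hM⟩ : ∃ M : ℕ, ∀ p : ℕ, M ≤ p → m p = 1 := by
    have ht := (tendsto_rpow_atTop ha).comp tendsto_natCast_atTop_atTop
    obtain ⟨M, hM⟩ := eventually_atTop.1 (ht.eventually (eventually_ge_atTop 2))
    exact ⟨M, fun p hp ↦ min_eq_left (by have := hM p hp; simp at this; linarith)⟩
  set D : ℝ := ∏ p ∈ (Finset.range M).filter Nat.Prime, m p with hD
  have hDpos : 0 < D := Finset.prod_pos fun p hp ↦ hmpos (Finset.mem_filter.1 hp).2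
  have hsub : divisorSigmaRange c ⊆ {z : ℂ | D ≤ ‖z‖} := by
    rintro z ⟨n, hn, rfl⟩
    rw [Set.mem_ofPred_eq, ← sigmaArith_apply,
      (isMultiplicative_sigmaArith c).multiplicative_factorization _ hn.ne', Finsupp.prod,
      norm_prod, Nat.support_factorization]
    have hfac : ∀ p ∈ n.primeFactors, m p ≤ ‖sigmaArith c (p ^ n.factorization p)‖ := by
      intro p hp
      have hpp := Nat.prime_of_mem_primeFactors hp
      have hnorm : ‖(p : ℂ) ^ c‖ = (p : ℝ) ^ a := norm_natCast_cpow_add_mul_I hpp.pos a b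
      rw [sigmaArith_apply, divisorSigma_prime_pow c hpp]
      refine (min_le_right _ _).trans ?_
      rw [← hnorm]
      refine norm_sub_one_le_norm_geom_sum ?_ ?_
      · rw [hnorm]
        exact Real.one_lt_rpow (by exact_mod_cast hpp.one_lt) ha
      · exact hpp.factorization_pos_of_dvd hn.ne' (Nat.dvd_of_mem_primeFactors hp)
    refine le_trans ?_ (Finset.prod_le_prod
      (fun p hp ↦ (hmpos (Nat.prime_of_mem_primeFactors hp)).le) hfac)
    have hle : D ≤ ∏ p ∈ (Finset.range M).filter Nat.Prime ∩ n.primeFactors, m p := by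
      rw [hD, ← Finset.prod_inter_mul_prod_sdiff _ n.primeFactors]
      refine mul_le_of_le_one_right (Finset.prod_nonneg fun p hp ↦ ?_)
        (Finset.prod_le_one (fun p hp ↦ ?_) fun p _ ↦ min_le_left _ _)
      · exact (hmpos (Finset.mem_filter.1 (Finset.mem_inter.1 hp).1).2).le
      · exact (hmpos (Finset.mem_filter.1 (Finset.mem_sdiff.1 hp).1).2).le
    refine hle.trans_eq (Finset.prod_subset Finset.inter_subset_right fun p hp hp' ↦ hM p ?_)
    by_contra hlt
    exact hp' (Finset.mem_inter.2 ⟨Finset.mem_filter.2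
      ⟨Finset.mem_range.2 (not_le.1 hlt), Nat.prime_of_mem_primeFactors hp⟩, hp⟩)
  have hcl : IsClosed {z : ℂ | D ≤ ‖z‖} := isClosed_le continuous_const continuous_norm
  have := closure_minimal hsub hcl (h 0)
  simp only [Set.mem_ofPred_eq, norm_zero] at this
  linarith

/-! ### Density for -1 ≤ a < 0. -/

lemma Finset.exists_subset_sum_mem_Icc {ι : Type*} [DecidableEq ι] {x : ι → ℝ} {δ t : ℝ}
    (ht : 0 ≤ t) (hδ : 0 ≤ δ) (T : Finset ι) (hx : ∀ i ∈ T, x i ≤ δ) (hT : t ≤ ∑ i ∈ T, x i) :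
    ∃ S ⊆ T, t ≤ ∑ i ∈ S, x i ∧ ∑ i ∈ S, x i ≤ t + δ := by
  induction T using Finset.induction_on with
  | empty => exact ⟨∅, subset_rfl, hT, by simpa using add_nonneg ht hδ⟩
  | insert i T hi ih =>
    rcases le_or_gt t (∑ j ∈ T, x j) with h | h
    · obtain ⟨S, hS, h'⟩ := ih (fun j hj ↦ hx j (Finset.mem_insert_of_mem hj)) h
      exact ⟨S, hS.trans (Finset.subset_insert i T), h'⟩
    · refine ⟨_, subset_rfl, hT, ?_⟩
      rw [Finset.sum_insert hi]
      linarith [hx i (Finset.mem_insert_self i T)]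

lemma exists_finset_primes_arc {b : ℝ} (hb : b ≠ 0) {u : ℂ} (hu : ‖u‖ = 1) {δ : ℝ} (hδ : 0 < δ)
    (M : ℕ) (t : ℝ) :
    ∃ T : Finset ℕ, (∀ p ∈ T, p.Prime ∧ M ≤ p ∧ ‖(p : ℂ) ^ (b * I) - u‖ < δ) ∧
      t ≤ ∑ p ∈ T, (1 : ℝ) / p := by
  classical
  by_contra! h
  refine not_summable_primes_arc hb hu hδ ?_
  have hs : Summable (Set.indicator {p : ℕ | p.Prime ∧ M ≤ p ∧ ‖(p : ℂ) ^ (b * I) - u‖ < δ}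
      fun n : ℕ ↦ (1 : ℝ) / n) := by
    refine summable_of_sum_le (c := t)
      (fun n ↦ Set.indicator_nonneg (fun _ _ ↦ by positivity) _) fun S ↦ ?_
    simp only [Set.indicator_apply]
    rw [← Finset.sum_filter]
    exact (h _ fun p hp ↦ (Finset.mem_filter.1 hp).2).le
  refine hs.congr_cofinite ?_
  rw [Nat.cofinite_eq_atTop]
  filter_upwards [eventually_ge_atTop M] with n hn
  simp [Set.indicator, hn]

lemma norm_log_one_add_cpow_sub_le {a b : ℝ} {u : ℂ} {δ : ℝ} (hδ : δ ≤ 1 / 2) {p : ℕ}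
    (hp : 0 < p) (hpa : (p : ℝ) ^ a ≤ δ) (harc : ‖(p : ℂ) ^ (b * I) - u‖ ≤ δ) :
    ‖log (1 + (p : ℂ) ^ ((a : ℂ) + b * I)) - ((p : ℝ) ^ a : ℝ) * u‖ ≤ 2 * δ * (p : ℝ) ^ a := by
  set z : ℂ := (p : ℂ) ^ ((a : ℂ) + b * I) with hz
  have hp0 : (p : ℂ) ≠ 0 := by exact_mod_cast hp.ne'
  have hnz : ‖z‖ = (p : ℝ) ^ a := norm_natCast_cpow_add_mul_I hp a b
  have hx : 0 ≤ (p : ℝ) ^ a := by positivity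
  have h1 : ‖log (1 + z) - z‖ ≤ δ * (p : ℝ) ^ a := by
    refine (norm_log_one_add_sub_self_le (by rw [hnz]; linarith)).trans ?_
    rw [hnz]
    have : (1 - (p : ℝ) ^ a)⁻¹ ≤ 2 := inv_le_of_inv_le₀ two_pos (by linarith)
    calc ((p : ℝ) ^ a) ^ 2 * (1 - (p : ℝ) ^ a)⁻¹ / 2 ≤ ((p : ℝ) ^ a) ^ 2 * 2 / 2 := by gcongr
      _ = (p : ℝ) ^ a * (p : ℝ) ^ a := by ring
      _ ≤ _ := by gcongr
  have h2 : z - ((p : ℝ) ^ a : ℝ) * u = ((p : ℝ) ^ a : ℝ) * ((p : ℂ) ^ (b * I) - u) := by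
    rw [hz, cpow_add _ _ hp0, ofReal_cpow p.cast_nonneg, ofReal_natCast]
    ring
  have h3 : ‖z - ((p : ℝ) ^ a : ℝ) * u‖ ≤ δ * (p : ℝ) ^ a := by
    rw [h2, norm_mul, norm_real, Real.norm_of_nonneg hx, mul_comm]
    gcongr
  calc _ = ‖(log (1 + z) - z) + (z - ((p : ℝ) ^ a : ℝ) * u)‖ := by rw [sub_add_sub_cancel]
    _ ≤ δ * (p : ℝ) ^ a + δ * (p : ℝ) ^ a := (norm_add_le _ _).trans (add_le_add h1 h3)
    _ = _ := by ring

lemma exp_mem_closure_divisorSigmaRange {a b : ℝ} (ha : -1 ≤ a) (ha0 : a < 0) (hb : b ≠ 0)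
    (l : ℂ) : exp l ∈ closure (divisorSigmaRange ((a : ℂ) + b * I)) := by
  classical
  set c : ℂ := (a : ℂ) + b * I with hc
  obtain ⟨u, hu, hl⟩ : ∃ u : ℂ, ‖u‖ = 1 ∧ l = (‖l‖ : ℂ) * u := by
    rcases eq_or_ne l 0 with rfl | h
    · exact ⟨1, by simp, by simp⟩
    · have h' : (‖l‖ : ℂ) ≠ 0 := by simpa using h
      exact ⟨l / ‖l‖, by simp [h], by field_simp⟩
  set t := ‖l‖ with ht
  have ht0 : 0 ≤ t := norm_nonneg _
  rw [Metric.mem_closure_iff]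
  intro ε hε
  obtain ⟨η, hη, hexp⟩ := Metric.continuousAt_iff.1 (continuous_exp.continuousAt (x := l)) ε hε
  obtain ⟨δ, hδ0, hδ1, hδη⟩ : ∃ δ : ℝ, 0 < δ ∧ δ ≤ 1 / 2 ∧ 2 * δ * (t + δ) + δ < η := by
    -- For δ ≤ 1/2 the left side is at most δ(2t + 2).
    refine ⟨min (1 / 2) (η / (2 * t + 3)), by positivity, min_le_left _ _, ?_⟩
    have h1 : min (1 / 2) (η / (2 * t + 3)) ≤ 1 / 2 := min_le_left _ _
    have h2 : min (1 / 2) (η / (2 * t + 3)) ≤ η / (2 * t + 3) := min_le_right _ _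
    have h0 : 0 < min (1 / 2) (η / (2 * t + 3)) := by positivity
    generalize min (1 / 2) (η / (2 * t + 3)) = δ at *
    rw [le_div_iff₀ (by positivity)] at h2
    nlinarith
  obtain ⟨M, hM⟩ : ∃ M : ℕ, ∀ p : ℕ, M ≤ p → (p : ℝ) ^ a ≤ δ := by
    have h := (tendsto_rpow_neg_atTop (neg_pos.2 ha0)).comp tendsto_natCast_atTop_atTop
    rw [neg_neg] at h
    obtain ⟨M, hM⟩ := eventually_atTop.1 (h.eventually (ge_mem_nhds hδ0))
    exact ⟨M, hM⟩
  obtain ⟨T, hT, hTt⟩ := exists_finset_primes_arc hb hu hδ0 M t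
  have hTa : t ≤ ∑ p ∈ T, (p : ℝ) ^ a := by
    refine hTt.trans (Finset.sum_le_sum fun p hp ↦ ?_)
    rw [one_div, ← Real.rpow_neg_one]
    exact Real.rpow_le_rpow_of_exponent_le (by exact_mod_cast (hT p hp).1.one_le) ha
  obtain ⟨S, hST, hS1, hS2⟩ := T.exists_subset_sum_mem_Icc ht0 hδ0.le
    (fun p hp ↦ hM p (hT p hp).2.1) hTa
  refine ⟨_, ⟨∏ p ∈ S, p, Finset.prod_pos fun p hp ↦ (hT p (hST hp)).1.pos, rfl⟩, ?_⟩
  have hprod : divisorSigma c (∏ p ∈ S, p) = exp (∑ p ∈ S, log (1 + (p : ℂ) ^ c)) := by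
    rw [divisorSigma_prod_primes c fun p hp ↦ (hT p (hST hp)).1, exp_sum]
    refine Finset.prod_congr rfl fun p hp ↦ (exp_log fun h ↦ ?_).symm
    have hn : ‖(p : ℂ) ^ c‖ = (p : ℝ) ^ a := norm_natCast_cpow_add_mul_I (hT p (hST hp)).1.pos a b
    rw [eq_neg_of_add_eq_zero_right h, norm_neg, norm_one] at hn
    linarith [hM p (hT p (hST hp)).2.1]
  rw [hprod, dist_comm]
  refine hexp ?_
  rw [dist_eq_norm]
  calc ‖∑ p ∈ S, log (1 + (p : ℂ) ^ c) - l‖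
      = ‖∑ p ∈ S, (log (1 + (p : ℂ) ^ c) - ((p : ℝ) ^ a : ℝ) * u) +
          ((∑ p ∈ S, (p : ℝ) ^ a - t : ℝ) : ℂ) * u‖ := by
        congr 1
        rw [Finset.sum_sub_distrib, ← Finset.sum_mul]
        nth_rewrite 1 [hl]
        push_cast
        ring
    _ ≤ ∑ p ∈ S, 2 * δ * (p : ℝ) ^ a + δ := by
        refine (norm_add_le _ _).trans (add_le_add ?_ ?_)
        · exact norm_sum_le_of_le _ fun p hp ↦ norm_log_one_add_cpow_sub_le hδ1
            (hT p (hST hp)).1.pos (hM p (hT p (hST hp)).2.1) (hT p (hST hp)).2.2.le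
        · rw [norm_mul, hu, mul_one, norm_real, Real.norm_of_nonneg (by linarith)]
          linarith
    _ ≤ 2 * δ * (t + δ) + δ := by
        rw [← Finset.mul_sum]
        gcongr
    _ < η := hδη

/-! ### Density for a = 0. -/

/-- The products `∏ (1 + p ^ c)` over finite sets of primes `p ≥ M`. -/
def primeProducts (c : ℂ) (M : ℕ) : Set ℂ :=
  {z | ∃ S : Finset ℕ, (∀ p ∈ S, p.Prime ∧ M ≤ p) ∧ ∏ p ∈ S, (1 + (p : ℂ) ^ c) = z}

lemma primeProducts_subset (c : ℂ) (M : ℕ) : primeProducts c M ⊆ divisorSigmaRange c := by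
  rintro z ⟨S, hS, rfl⟩
  exact ⟨∏ p ∈ S, p, Finset.prod_pos fun p hp ↦ (hS p hp).1.pos,
    divisorSigma_prod_primes c fun p hp ↦ (hS p hp).1⟩

/-- The numbers that are limits of products `∏ (1 + p ^ c)` over finite sets of arbitrarily large
primes. -/
def limitPrimeProducts (c : ℂ) : Submonoid ℂ where
  carrier := {z | ∀ M, z ∈ closure (primeProducts c M)}
  one_mem' M := subset_closure ⟨∅, by simp, by simp⟩
  mul_mem' := by
    classical
    intro x y hx hy M
    rw [← closure_closure]
    refine map_mem_closure (f := (· * y)) (by fun_prop) (hx M) ?_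
    rintro z ⟨S, hS, rfl⟩
    -- Primes beyond `S.sup id` make the second set disjoint from `S`.
    refine map_mem_closure (f := (_ * ·)) (by fun_prop) (hy (max M (S.sup id + 1))) ?_
    rintro z ⟨S', hS', rfl⟩
    refine ⟨S ∪ S', fun p hp ↦ ?_, Finset.prod_union (Finset.disjoint_left.2 fun p hp hp' ↦ ?_)⟩
    · rcases Finset.mem_union.1 hp with h | h
      · exact hS p h
      · exact ⟨(hS' p h).1, (le_max_left _ _).trans (hS' p h).2⟩
    · have h1 : p ≤ S.sup id := Finset.le_sup (f := id) hp
      have h2 := (le_max_right _ _).trans (hS' p hp').2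
      omega

lemma one_add_mem_limitPrimeProducts {b : ℝ} (hb : b ≠ 0) {u : ℂ} (hu : ‖u‖ = 1) :
    1 + u ∈ limitPrimeProducts (b * I) := by
  intro M
  rw [Metric.mem_closure_iff]
  intro ε hε
  obtain ⟨T, hT, h1⟩ := exists_finset_primes_arc hb hu hε M 1
  obtain ⟨p, hp⟩ : T.Nonempty := by
    by_contra h
    rw [Finset.not_nonempty_iff_eq_empty.1 h] at h1
    norm_num at h1
  refine ⟨1 + (p : ℂ) ^ (b * I), ⟨{p}, by simpa using ⟨(hT p hp).1, (hT p hp).2.1⟩, by simp⟩, ?_⟩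
  rw [dist_comm, dist_eq_norm, add_sub_add_left_eq_sub]
  exact (hT p hp).2.2

/-- With u, v = e^(i(β ± γ)) the product is e^(iβ)(2 cos β + 2 cos γ); the hypotheses put the
required cos γ in [-1, 1]. -/
lemma exists_one_add_mul_one_add_eq_exp {x β : ℝ} (hx : Real.exp x ≤ 2) (hβ : 0 ≤ Real.cos β) :
    ∃ u v : ℂ, ‖u‖ = 1 ∧ ‖v‖ = 1 ∧ (1 + u) * (1 + v) = exp (x + β * I) := by
  set γ := Real.arccos (Real.exp x / 2 - Real.cos β) with hγ
  have hcos : Real.cos γ = Real.exp x / 2 - Real.cos β :=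
    Real.cos_arccos (by linarith [Real.exp_pos x, Real.cos_le_one β]) (by linarith)
  refine ⟨exp ((β + γ : ℝ) * I), exp ((β - γ : ℝ) * I), norm_exp_ofReal_mul_I _,
    norm_exp_ofReal_mul_I _, ?_⟩
  have hx' : exp x = 2 * cos β + 2 * cos γ := by
    rw [← ofReal_exp, ← ofReal_cos, ← ofReal_cos, hcos]
    push_cast
    ring
  have e1 : exp ((β + γ : ℝ) * I) = exp (β * I) * exp (γ * I) := by
    rw [← exp_add]; push_cast; ring_nf
  have e2 : exp ((β - γ : ℝ) * I) = exp (β * I) * exp (-γ * I) := by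
    rw [← exp_add]; push_cast; ring_nf
  have g : exp (γ * I) * exp (-γ * I) = 1 := by rw [← exp_add]; simp
  have h : exp (β * I) * exp (-β * I) = 1 := by rw [← exp_add]; simp
  rw [exp_add, hx', two_cos, two_cos, e1, e2]
  linear_combination (exp (β * I)) ^ 2 * g - h

/-- For large m, exp(l/m) is a product of two factors 1 + u; take its m-th power in the submonoid.
-/
lemma exp_mem_limitPrimeProducts {b : ℝ} (hb : b ≠ 0) (l : ℂ) :
    exp l ∈ limitPrimeProducts (b * I) := by
  have hlim (y : ℝ) : Tendsto (fun m : ℕ ↦ y / m) atTop (𝓝 0) :=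
    tendsto_const_div_atTop_nhds_zero_nat y
  have h1 : ∀ᶠ m : ℕ in atTop, Real.exp (l.re / m) < 2 :=
    ((Real.continuous_exp.tendsto 0).comp (hlim l.re)).eventually
      (gt_mem_nhds (by norm_num))
  have h2 : ∀ᶠ m : ℕ in atTop, 0 < Real.cos (l.im / m) :=
    ((Real.continuous_cos.tendsto 0).comp (hlim l.im)).eventually
      (lt_mem_nhds (by norm_num))
  obtain ⟨m, ⟨hm1, hm2⟩, hm⟩ := ((h1.and h2).and (eventually_ge_atTop 1)).exists
  obtain ⟨u, v, hu, hv, huv⟩ := exists_one_add_mul_one_add_eq_exp hm1.le hm2.le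
  have hm0 : (m : ℂ) ≠ 0 := by exact_mod_cast (by omega : m ≠ 0)
  have hl : l = m * (((l.re / m : ℝ) : ℂ) + (l.im / m : ℝ) * I) := by
    push_cast
    field_simp
    exact (re_add_im l).symm
  rw [hl, exp_nat_mul, ← huv]
  exact pow_mem (mul_mem (one_add_mem_limitPrimeProducts hb hu)
    (one_add_mem_limitPrimeProducts hb hv)) m

theorem dense_divisorSigmaRange {a b : ℝ} (ha : -1 ≤ a) (ha0 : a ≤ 0) (hb : b ≠ 0) :
    Dense (divisorSigmaRange ((a : ℂ) + b * I)) := by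
  have hexp (l : ℂ) : exp l ∈ closure (divisorSigmaRange ((a : ℂ) + b * I)) := by
    rcases ha0.lt_or_eq with h | rfl
    · exact exp_mem_closure_divisorSigmaRange ha h hb l
    · rw [ofReal_zero, zero_add]
      exact closure_mono (primeProducts_subset _ 0) (exp_mem_limitPrimeProducts hb l 0)
  have hd : Dense ({0}ᶜ : Set ℂ) := dense_compl_singleton 0
  refine dense_closure.1 (hd.mono fun w hw ↦ ?_)
  rw [← exp_log hw]
  exact hexp _

end

theorem theorem3p1 (a b : ℝ) :
    Dense (divisorSigmaRange ((a : ℂ) + (b : ℂ) * Complex.I)) ↔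
      (-1 ≤ a ∧ a ≤ 0) ∧ b ≠ 0 := by
  refine ⟨fun h ↦ ⟨⟨?_, ?_⟩, ?_⟩, fun h ↦ dense_divisorSigmaRange h.1.1 h.1.2 h.2⟩
  · by_contra ha
    exact not_dense_divisorSigmaRange_of_lt_neg_one (not_le.1 ha) b h
  · by_contra ha
    exact not_dense_divisorSigmaRange_of_pos (not_le.1 ha) b h
  · rintro rfl
    exact not_dense_divisorSigmaRange_real a (by simpa using h)
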